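/- **Definitions.** Let $X,Y$ be finite sets and $f:X\times Y\to\{0,1\}$; $\log$ is to base $2$. A *rectangle* is a product set $R=A\times B$ with $A\subseteq X$, $B\subseteq Y$. * *Rectangle bound.* For a probability distribution $\mu$ on $X\times Y$ let $\mathrm{err}(R,\mu,1)=\mu(f^{-1}(0)\mid R)$ (read as $0$ if $\mu(R)=0$), and $\mathrm{size}(\mu,\epsilon,f,1)=\max\{\mu(R): R \text{ a rectangle},\ \mathrm{err}(R,\mu,1)\le\epsilon\}$. Then $bound^{(1)}(f)=\sup_\mu\log\bigl(1/\mathrm{size}(\mu,\tfrac14,f,1)\bigr)$, where $\mu$ runs over all distributions with $\tfrac14\le\mu(f^{-1}(0)),\mu(f^{-1}(1))\le\tfrac34$. * *One-sided uniform threshold covers.* For integers $s,t\ge 0$, a one-sided uniform threshold cover of $f$ with parameters $s,t$ is a finite family of rectangles (repetitions allowed) such that every input with $f(x,y)=1$ lies in at least $t$ of them and every input with $f(x,y)=0$ lies in at most $s$ of them. It has bounded error if $t\ge 2s$. $UT^{(1)}_{s,t}(f)=\lceil\log P\rceil$, where $P$ is the minimal size of such a cover. * *Approximate majority covers.* An approximate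 majority cover of $f$ is a finite set of rectangles labeled by $0$ or $1$ such that, for every input, among the labeled rectangles containing it the majority (ties broken in favor of $f(x,y)=1$), and at least a $\tfrac34$ fraction, bear the label $f(x,y)$. $APP(f)$ is the logarithm of the minimal size of such a cover. * *Merlin Arthur complexity.* In a Merlin Arthur protocol, a guess $z\in\{0,1\}^k$, known to both players, is followed by a public-coin randomized two-party protocol (that may depend on $z$). The protocol computes $f$ (with error $\tfrac14$) if for $f(x,y)=1$ some $z$ is accepted with probability at least $\tfrac34$, and for $f(x,y)=0$ every $z$ is accepted with probability at most $\tfrac14$. Its complexity is $k$ plus the maximal number of bits exchanged (over inputs, guesses and coin tosses). $MA(f)$ is the minimal complexity of such a protocol for $f$. Let $DISJ(x,y)=\bigwedge_{i=1}^n(\neg x_i\vee\neg y_i)$ for $x,y\in\{0,1\}^n$, and let $$BOTH_n:(\{0,1\}^n\times\{0,1\}^n\times\{0,1\})\times(\{0,1\}^n\times\{0,1\}^n)\to\{0,1\},$$ $$BOTH_n((x_1,x_2,a),(y_1,y_2))=(DISJ(x_1,y_1)\wedge a)\vee(\neg DISJ(x_2,y_2)\wedge\neg a).$$ **Theorem.**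 As $n\to\infty$, $$APP(BOTH_n)=O(\log n),$$ $$bound^{(1)}(BOTH_n)=\Omega(n),\qquad bound^{(1)}(\neg BOTH_n)=\Omega(n).$$ Moreover, with constants that do not depend on $s$, for all integers $s\ge1$, $$UT^{(1)}_{s,2s}(BOTH_n)=\Omega(n),\qquad UT^{(1)}_{s,2s}(\neg BOTH_n)=\Omega(n),$$ and $$MA(BOTH_n)=\Omega(\sqrt n),\qquad MA(\neg BOTH_n)=\Omega(\sqrt n).$$ -/

import Mathlib

namespace CommCx

universe u v

/-! ### Rectangles and the rectangle bound

A communication problem is a function `f : X → Y → Bool` on finite sets of inputs; `X` indexes the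
rows and `Y` the columns of the communication matrix.  A probability distribution on the inputs is
an element of `stdSimplex ℝ (X × Y)`.  All logarithms have base 2. -/

section Rectangles

variable {X : Type u} {Y : Type v}

/-- The complement `¬ f` of a communication problem. -/
def neg (f : X → Y → Bool) : X → Y → Bool := fun x y => !(f x y)

/-- A rectangle is a product set. -/
def IsRectangle (R : Finset (X × Y)) : Prop :=
  ∃ (A : Finset X) (B : Finset Y), R = A ×ˢ B

/-- The size `μ(S)` of a set of inputs. -/
def mass (μ : X × Y → ℝ) (S : Finset (X × Y)) : ℝ := ∑ p ∈ S, μ p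

/-- `err(R, μ, v) = μ(f⁻¹(1 - v) | R)`, the error of `R` as a `v`-rectangle
(it is `0` if `μ(R) = 0`). -/
noncomputable def err (f : X → Y → Bool) (μ : X × Y → ℝ) (R : Finset (X × Y)) (v : Bool) : ℝ :=
  mass μ (R.filter fun p => f p.1 p.2 = !v) / mass μ R

/-- `size(μ, ε, f, v)`, the largest size of a rectangle with error at most `ε` as a
`v`-rectangle; the maximum is over a finite set that contains the size of the empty rectangle. -/
noncomputable def size (μ : X × Y → ℝ) (ε : ℝ) (f : X → Y → Bool) (v : Bool) : ℝ :=
  sSup {m : ℝ | ∃ R : Finset (X × Y), IsRectangle R ∧ err f μ R v ≤ ε ∧ m = mass μ R}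

variable [Fintype X] [Fintype Y]

/-- `μ` is a probability distribution on the inputs that is `α`-balanced for `f`:
`α ≤ μ(f⁻¹(1)), μ(f⁻¹(0)) ≤ 1 - α`. -/
def IsBalanced (α : ℝ) (f : X → Y → Bool) (μ : X × Y → ℝ) : Prop :=
  μ ∈ stdSimplex ℝ (X × Y) ∧
    ∀ v : Bool, mass μ (Finset.univ.filter fun p => f p.1 p.2 = v) ∈ Set.Icc α (1 - α)

/-- `bound⁽¹⁾_ε(f)`: the supremum of `log (1 / size(μ, ε, f, 1))` over all `1/4`-balanced
distributions.  (For such `μ` some 1-input has weight at least `1 / (4 |X| |Y|)`, so that the size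
is positive and the supremum is over a bounded set when `0 ≤ ε`.) -/
noncomputable def bound1Err (ε : ℝ) (f : X → Y → Bool) : ℝ :=
  sSup {b : ℝ | ∃ μ : X × Y → ℝ, IsBalanced (1 / 4) f μ ∧ b = Real.logb 2 (1 / size μ ε f true)}

/-- `bound⁽¹⁾(f)` is `bound⁽¹⁾_ε(f)` for `ε = 1/4`. -/
noncomputable def bound1 (f : X → Y → Bool) : ℝ := bound1Err (1 / 4) f

end Rectangles

/-! ### Covers -/

section Covers

variable {X : Type u} {Y : Type v}

open Classical in
/-- A one-sided uniform threshold cover of `f` with parameters `s, t` that has `P` rectangles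
(repetitions are allowed): inputs with `f(x,y) = 1` lie in at least `t` of the rectangles, inputs
with `f(x,y) = 0` in at most `s` of them. -/
def IsOneSidedUTCover (s t : ℕ) (f : X → Y → Bool) (P : ℕ) (R : Fin P → Finset (X × Y)) : Prop :=
  (∀ i, IsRectangle (R i)) ∧
    ∀ x y,
      (f x y = true → t ≤ (Finset.univ.filter fun i => (x, y) ∈ R i).card) ∧
      (f x y = false → (Finset.univ.filter fun i => (x, y) ∈ R i).card ≤ s)

/-- `UT⁽¹⁾_{s,t}(f) = ⌈log P⌉`, where `P` is the minimal size of a one-sided uniform threshold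
cover of `f` with parameters `s, t`. -/
noncomputable def UT1 (s t : ℕ) (f : X → Y → Bool) : ℕ :=
  ⌈Real.logb 2 (sInf {P : ℕ | ∃ R : Fin P → Finset (X × Y), IsOneSidedUTCover s t f P R} : ℕ)⌉₊

open Classical in
/-- The number of rectangles of `C` that are adjacent to (i.e. contain) the input `(x, y)` and bear
the label `v`. -/
noncomputable def labelCount (C : Finset (Finset (X × Y) × Bool)) (x : X) (y : Y) (v : Bool) : ℕ :=
  (C.filter fun R => (x, y) ∈ R.1 ∧ R.2 = v).card

/-- A majority cover: a set of labeled rectangles such that for each input the majority of the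
adjacent rectangles bears the correct label, ties being broken in favor of `f(x,y) = 1`. -/
def IsMajorityCover (f : X → Y → Bool) (C : Finset (Finset (X × Y) × Bool)) : Prop :=
  (∀ R ∈ C, IsRectangle R.1) ∧
    ∀ x y,
      (f x y = true → labelCount C x y false ≤ labelCount C x y true) ∧
      (f x y = false → labelCount C x y true < labelCount C x y false)

/-- An approximate majority cover: a majority cover in which for each input at least `3/4` of the
adjacent rectangles bear the correct label. -/
def IsApproxMajorityCover (f : X → Y → Bool) (C : Finset (Finset (X × Y) × Bool)) : Prop :=
  IsMajorityCover f C ∧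
    ∀ x y, (3 / 4 : ℝ) * (labelCount C x y true + labelCount C x y false) ≤
      labelCount C x y (f x y)

/-- `APP(f)`, the logarithm of the minimal size of an approximate majority cover of `f`. -/
noncomputable def APP (f : X → Y → Bool) : ℝ :=
  Real.logb 2
    (sInf {P : ℕ | ∃ C : Finset (Finset (X × Y) × Bool),
      IsApproxMajorityCover f C ∧ C.card = P} : ℕ)

end Covers

/-! ### Merlin Arthur protocols -/

/-- Deterministic two-party protocol trees: at an inner node Alice or Bob sends one bit, which
depends on the own input and (through the node) on the bits exchanged so far; a leaf carries the
output. -/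
inductive Protocol (X : Type u) (Y : Type v) : Type (max u v)
  | leaf (output : Bool) : Protocol X Y
  | alice (bit : X → Bool) (next0 next1 : Protocol X Y) : Protocol X Y
  | bob (bit : Y → Bool) (next0 next1 : Protocol X Y) : Protocol X Y

namespace Protocol

variable {X : Type u} {Y : Type v}

/-- The output of the protocol on the input `(x, y)`. -/
def run : Protocol X Y → X → Y → Bool
  | leaf b, _, _ => b
  | alice q p0 p1, x, y => if q x then p1.run x y else p0.run x y
  | bob q p0 p1, x, y => if q y then p1.run x y else p0.run x y

/-- The communication complexity of the protocol: the worst case number of bits exchanged. -/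
def depth : Protocol X Y → ℕ
  | leaf _ => 0
  | alice _ p0 p1 => 1 + max p0.depth p1.depth
  | bob _ p0 p1 => 1 + max p0.depth p1.depth

end Protocol

section MerlinArthur

variable {X : Type u} {Y : Type v}

/-- A Merlin Arthur protocol: Merlin's guess is a string of `k` bits known to both players, and for
each guess the players perform a randomized public coin protocol, i.e. a deterministic protocol
that is drawn from a probability distribution. -/
structure MAProtocol (X : Type u) (Y : Type v) where
  k : ℕ
  rand : (Fin k → Bool) → PMF (Protocol X Y)

/-- The probability that the protocol accepts the input `(x, y)` on the guess `z`. -/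
noncomputable def MAProtocol.acceptProb (M : MAProtocol X Y) (z : Fin M.k → Bool) (x : X) (y : Y) :
    ℝ :=
  (((M.rand z).map fun π => π.run x y) true).toReal

/-- `M` computes `f` with error `ε`. -/
def MAProtocol.Computes (M : MAProtocol X Y) (ε : ℝ) (f : X → Y → Bool) : Prop :=
  ∀ x y,
    (f x y = true → ∃ z, 1 - ε ≤ M.acceptProb z x y) ∧
    (f x y = false → ∀ z, M.acceptProb z x y ≤ ε)

/-- The complexity of `M` is at most `c`: the length of the guess plus the communication is at most
`c`, for all guesses and all outcomes of the coin tosses. -/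
def MAProtocol.CostLE (M : MAProtocol X Y) (c : ℕ) : Prop :=
  ∀ z, ∀ π ∈ (M.rand z).support, M.k + π.depth ≤ c

/-- `MA_ε(f)`, the complexity of an optimal Merlin Arthur protocol for `f` with error `ε`. -/
noncomputable def MAErr (ε : ℝ) (f : X → Y → Bool) : ℕ :=
  sInf {c : ℕ | ∃ M : MAProtocol X Y, M.Computes ε f ∧ M.CostLE c}

/-- `MA(f)` is `MA_ε(f)` for `ε = 1/4`. -/
noncomputable def MA (f : X → Y → Bool) : ℕ := MAErr (1 / 4) f

end MerlinArthur

/-! ### The function BOTH -/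

/-- Bit strings of length `n`. -/
abbrev Str (n : ℕ) : Type := Fin n → Bool

/-- Set disjointness: `DISJ(x, y) = ⋀ i, (¬ x i ∨ ¬ y i)`. -/
def DISJ (n : ℕ) (x y : Str n) : Bool := decide (∀ i, (!x i || !y i) = true)

/-- `BOTH((x₁, x₂, a), (y₁, y₂)) = (DISJ(x₁, y₁) ∧ a) ∨ (¬ DISJ(x₂, y₂) ∧ ¬ a)`. -/
def BOTH (n : ℕ) (p : Str n × Str n × Bool) (q : Str n × Str n) : Bool :=
  (DISJ n p.1 q.1 && p.2.2) || (!DISJ n p.2.1 q.2 && !p.2.2)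

end CommCx

/-!
Both `BOTH` and its negation contain set disjointness as a submatrix (fix `a`), so all lower bounds
follow from one property of disjointness, `HasCorruption`: there are distributions `α` on the
1-inputs and `β` on the 0-inputs with `β(R) ≥ 3/4 α(R) - η` for all rectangles `R`, where `η` is
exponentially small in `n` (Razborov's corruption lemma, `corruption_sum`).

For disjointness, `α` is the distribution of `(x ∧ z, y ∧ ¬z)` for uniform `x, y, z`, and `β` is
obtained from it by inserting a common random element `i`. Given `z`, rows and columns are
independent. If the set of rows of `R` has weight at least `exp (-δ n)` given `z`, then by the
level-one inequality (`level_one`, a consequence of Jensen's inequality for `exp`) membership of a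
typical `i` in the row hardly influences the weight; likewise for columns. Conditioning on `i` being
in both sets hence preserves the weight of the rectangle up to a small loss (`sum_slice_mul_le`).

The property bounds every measure from below. Under `(α + β) / 2` a rectangle with error at most
`1/4` has `3 β(R) ≤ α(R)`, so that it is small (`HasCorruption.le_bound1`). The inequality extends
linearly to nonnegative combinations of rectangles (`HasCorruption.le_of_isRectSum`). This applies
to the counting function of a uniform threshold cover, and to the function
`∑ z, (acceptance probability on the guess z) ^ (k + 1)` of a Merlin Arthur protocol
with guesses of length `k`: the power is large enough to beat the union bound over the `2 ^ k`
guesses, and costs `k + 1` times the communication, whence the square root.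

For the upper bound on `APP`, the default answer is `a`, given by one rectangle, and it is
overruled by rectangles that exhibit an intersection. A cover is a set and not a multiset, so these
rectangles are split according to a bit of the irrelevant string, in `n` different ways, in order
to outweigh the default.
-/

namespace CommCx

open Finset

/-! ### Fourier weight on the first level -/

section Cube

variable {n : ℕ}

/-- The sign `(-1) ^ b` of a bit. -/
def bitSign (b : Bool) : ℝ := if b then -1 else 1

theorem abs_bitSign (b : Bool) : |bitSign b| = 1 := by
  cases b <;> simp [bitSign]

theorem sum_update (i : Fin n) (b : Bool) (h : Str n → ℝ) :
    ∑ x, h (Function.update x i b) = 2 * ∑ x, if x i = b then h x else 0 := by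
  have hflip : Function.Involutive fun x : Str n => Function.update x i (!x i) := by
    intro x
    simp
  have h1 : ∑ x : Str n, (if x i = b then 0 else h (Function.update x i b)) =
      ∑ x : Str n, if x i = b then h (Function.update x i b) else 0 := by
    rw [← Equiv.sum_comp hflip.toPerm]
    refine sum_congr rfl fun x _ => ?_
    cases hx : x i <;> cases b <;> simp [hx]
  have h2 : ∑ x : Str n, (if x i = b then h (Function.update x i b) else 0) =
      ∑ x : Str n, if x i = b then h x else 0 := by
    refine sum_congr rfl fun x _ => ?_
    split_ifs with hx
    · rw [← hx, Function.update_eq_self]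
    · rfl
  rw [two_mul, ← h2]
  nth_rewrite 1 [← h1]
  rw [← sum_add_distrib]
  refine sum_congr rfl fun x _ => ?_
  split_ifs <;> simp

/-- A Rademacher sum with signs is sub-Gaussian. -/
theorem sum_exp_signed_le (l : ℝ) (s : Fin n → ℝ) (hs : ∀ i, |s i| = 1) :
    ∑ x : Str n, Real.exp (l * ∑ i, s i * bitSign (x i)) ≤ 2 ^ n * Real.exp (n * (l ^ 2 / 2)) := by
  have h1 : ∑ x : Str n, Real.exp (l * ∑ i, s i * bitSign (x i)) =
      ∏ i : Fin n, ∑ b : Bool, Real.exp (l * (s i * bitSign b)) := by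
    rw [Finset.prod_univ_sum, Fintype.piFinset_univ]
    refine sum_congr rfl fun x _ => ?_
    rw [mul_sum, Real.exp_sum]
  have h2 : ∀ i : Fin n, ∑ b : Bool, Real.exp (l * (s i * bitSign b)) ≤
      2 * Real.exp (l ^ 2 / 2) := by
    intro i
    have h3 := Real.cosh_le_exp_half_sq (l * s i)
    rw [Real.cosh_eq, mul_pow, ← sq_abs (s i), hs i] at h3
    simp only [Fintype.sum_bool, bitSign]
    norm_num at h3 ⊢
    linarith
  calc _ = _ := h1
    _ ≤ ∏ _i : Fin n, 2 * Real.exp (l ^ 2 / 2) :=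
        prod_le_prod (fun i _ => sum_nonneg fun b _ => (Real.exp_pos _).le) fun i _ => h2 i
    _ = _ := by rw [prod_const, card_univ, Fintype.card_fin, mul_pow, ← Real.exp_nat_mul]

/-- A level-one inequality: a `[0, 1]`-valued function on the cube whose mean is at least
`exp (-n / 3200)` has average correlation at most `1 / 40` of its mean with the coordinates.
Smaller functions are accounted for by the exponentially small additive term. -/
theorem level_one (f : Str n → ℝ) (h0 : ∀ x, 0 ≤ f x) (h1 : ∀ x, f x ≤ 1) :
    ∑ i, |∑ x, f x * bitSign (x i)| ≤
      n * ((∑ x, f x) / 40 + 2 ^ n * Real.exp (-(n / 3200 : ℝ))) := by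
  set F := ∑ x, f x with hF
  have hF0 : 0 ≤ F := sum_nonneg fun x _ => h0 x
  have hE : (0 : ℝ) < 2 ^ n * Real.exp (-(n / 3200 : ℝ)) := by positivity
  rcases le_or_gt F (2 ^ n * Real.exp (-(n / 3200 : ℝ))) with hs | hs
  · -- Small functions: each coefficient is trivially at most the mean.
    have : ∀ i : Fin n, |∑ x, f x * bitSign (x i)| ≤ F := fun i =>
      (abs_sum_le_sum_abs _ _).trans (sum_le_sum fun x _ => by
        rw [abs_mul, abs_bitSign, mul_one, abs_of_nonneg (h0 x)])
    calc _ ≤ ∑ _i : Fin n, F := sum_le_sum fun i _ => this i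
      _ = n * F := by simp
      _ ≤ _ := by gcongr; linarith
  have hFpos : 0 < F := hE.trans hs
  -- `s i` is the sign of the `i`-th coefficient.
  obtain ⟨s, hs1, hs2⟩ : ∃ s : Fin n → ℝ, (∀ i, |s i| = 1) ∧
      ∀ i, |∑ x, f x * bitSign (x i)| = s i * ∑ x, f x * bitSign (x i) := by
    refine ⟨fun i => if 0 ≤ ∑ x, f x * bitSign (x i) then 1 else -1, fun i => ?_, fun i => ?_⟩
    · dsimp only
      split_ifs <;> simp
    · dsimp only
      split_ifs with h
      · rw [abs_of_nonneg h, one_mul]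
      · rw [abs_of_neg (not_le.1 h), neg_one_mul]
  set L : Str n → ℝ := fun x => ∑ i, s i * bitSign (x i) with hL
  have hsum : ∑ i, |∑ x, f x * bitSign (x i)| = ∑ x, f x * L x := by
    simp_rw [hs2, hL, mul_sum]
    rw [sum_comm]
    exact sum_congr rfl fun x _ => sum_congr rfl fun i _ => by ring
  -- Jensen for the probability weights `f x / F`; the parameter `1 / 40` balances `l ^ 2 / 2`
  -- against the entropy deficiency `1 / 3200` per coordinate.
  have hJ : Real.exp (∑ x, (f x / F) * (1 / 40 * L x)) ≤
      ∑ x, (f x / F) * Real.exp (1 / 40 * L x) := by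
    have := convexOn_exp.map_sum_le (t := univ) (w := fun x => f x / F)
      (p := fun x => 1 / 40 * L x) (fun x _ => div_nonneg (h0 x) hF0)
      (by rw [← sum_div, ← hF, div_self hFpos.ne']) (fun x _ => Set.mem_univ _)
    simpa only [smul_eq_mul] using this
  have hK : ∑ x, (f x / F) * Real.exp (1 / 40 * L x) ≤
      1 / F * (2 ^ n * Real.exp (n * ((1 / 40) ^ 2 / 2))) := by
    calc _ ≤ ∑ x, 1 / F * Real.exp (1 / 40 * L x) := sum_le_sum fun x _ => by
            gcongr; exact h1 x
      _ ≤ _ := by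
            rw [← mul_sum]
            gcongr
            exact sum_exp_signed_le _ s hs1
  have hM : 1 / F * (2 ^ n * Real.exp (n * ((1 / 40) ^ 2 / 2))) ≤ Real.exp (n / 1600) := by
    rw [one_div_mul_eq_div, div_le_iff₀ hFpos]
    calc _ = Real.exp (n / 1600) * (2 ^ n * Real.exp (-(n / 3200 : ℝ))) := by
            rw [mul_left_comm, ← Real.exp_add]
            congr 2
            ring
      _ ≤ _ := by gcongr
  have hN := Real.exp_le_exp.1 (hJ.trans (hK.trans hM))
  have hO : ∑ x, (f x / F) * (1 / 40 * L x) = (∑ x, f x * L x) / (40 * F) := by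
    rw [sum_div]
    refine sum_congr rfl fun x _ => ?_
    field_simp
  rw [hO, div_le_iff₀ (by positivity)] at hN
  rw [hsum]
  have : (0 : ℝ) ≤ n * (2 ^ n * Real.exp (-(n / 3200 : ℝ))) := by positivity
  linarith

/-! ### Corruption of large rectangles for disjointness -/

/-- The sum of `f` over the subsets of `z`, each with multiplicity `2 ^ (n - |z|)`. -/
def slice (f : Str n → ℝ) (z : Str n) : ℝ := ∑ x, f (x ⊓ z)

/-- The variant of `slice` in which the membership of `i` is fixed to be `b`. -/
def sliceAt (f : Str n → ℝ) (i : Fin n) (b : Bool) (z : Str n) : ℝ :=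
  ∑ x, f (Function.update (x ⊓ z) i b)

theorem sliceAt_update (f : Str n → ℝ) (i : Fin n) (b c : Bool) (z : Str n) :
    sliceAt f i b (Function.update z i c) = sliceAt f i b z := by
  unfold sliceAt
  refine sum_congr rfl fun x _ => congrArg f ?_
  ext j
  by_cases hj : j = i
  · subst hj; simp
  · simp [hj]

theorem compl_update (z : Str n) (i : Fin n) (c : Bool) :
    (Function.update z i c)ᶜ = Function.update zᶜ i (!c) := by
  ext j
  by_cases hj : j = i
  · subst hj; simp
  · simp [hj]

theorem slice_of_not_mem (f : Str n → ℝ) {i : Fin n} {z : Str n} (hz : z i = false) :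
    slice f z = sliceAt f i false z := by
  refine sum_congr rfl fun x _ => congrArg f ?_
  ext j
  by_cases hj : j = i
  · subst hj; simp [hz]
  · simp [hj]

theorem sliceAt_of_mem (f : Str n → ℝ) {i : Fin n} {z : Str n} (hz : z i = true) (b : Bool) :
    sliceAt f i b z = 2 * ∑ x : Str n, if x i = b then f (x ⊓ z) else 0 := by
  rw [← sum_update i b fun x => f (x ⊓ z)]
  refine sum_congr rfl fun x _ => congrArg f ?_
  ext j
  by_cases hj : j = i
  · subst hj; simp [hz]
  · simp [hj]

theorem slice_of_mem (f : Str n → ℝ) {i : Fin n} {z : Str n} (hz : z i = true) :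
    slice f z = (sliceAt f i false z + sliceAt f i true z) / 2 := by
  rw [sliceAt_of_mem f hz, sliceAt_of_mem f hz, ← mul_add, ← sum_add_distrib,
    mul_div_cancel_left₀ _ two_ne_zero]
  refine sum_congr rfl fun x _ => ?_
  cases x i <;> simp

theorem sliceAt_sub_of_mem (f : Str n → ℝ) {i : Fin n} {z : Str n} (hz : z i = true) :
    sliceAt f i false z - sliceAt f i true z = 2 * ∑ x : Str n, f (x ⊓ z) * bitSign (x i) := by
  rw [sliceAt_of_mem f hz, sliceAt_of_mem f hz, ← mul_sub, ← sum_sub_distrib]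
  congr 1
  refine sum_congr rfl fun x _ => ?_
  cases x i <;> simp [bitSign]

theorem slice_nonneg {f : Str n → ℝ} (h0 : ∀ x, 0 ≤ f x) (z : Str n) : 0 ≤ slice f z :=
  sum_nonneg fun _ _ => h0 _

theorem sliceAt_nonneg {f : Str n → ℝ} (h0 : ∀ x, 0 ≤ f x) (i : Fin n) (b : Bool) (z : Str n) :
    0 ≤ sliceAt f i b z :=
  sum_nonneg fun _ _ => h0 _

theorem slice_le {f : Str n → ℝ} (h1 : ∀ x, f x ≤ 1) (z : Str n) : slice f z ≤ 2 ^ n := by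
  calc slice f z ≤ ∑ _x : Str n, (1 : ℝ) := sum_le_sum fun _ _ => h1 _
    _ = 2 ^ n := by simp

/-- The loss incurred in row direction: how much, summed over the `z` that contain `i` and weighted
with the columns, membership of `i` influences the weight of the rows. -/
def rowLoss (f g : Str n → ℝ) (i : Fin n) : ℝ :=
  ∑ z : Str n, if z i = true then |sliceAt f i false z - sliceAt f i true z| * slice g zᶜ else 0

theorem sum_rowLoss_le {f g : Str n → ℝ} (hf0 : ∀ x, 0 ≤ f x) (hf1 : ∀ x, f x ≤ 1)
    (hg0 : ∀ x, 0 ≤ g x) (hg1 : ∀ x, g x ≤ 1) :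
    ∑ i, rowLoss f g i ≤ n * ((∑ z, slice f z * slice g zᶜ) / 20 +
      2 * (2 ^ n) ^ 3 * Real.exp (-(n / 3200 : ℝ))) := by
  unfold rowLoss
  rw [sum_comm]
  have key : ∀ z : Str n, (∑ i, if z i = true then
      |sliceAt f i false z - sliceAt f i true z| * slice g zᶜ else 0) ≤
      n * (slice f z * slice g zᶜ / 20 + 2 * (2 ^ n) ^ 2 * Real.exp (-(n / 3200 : ℝ))) := by
    intro z
    have hg := slice_nonneg hg0 zᶜ
    calc _ ≤ ∑ i, 2 * |∑ x : Str n, f (x ⊓ z) * bitSign (x i)| * slice g zᶜ := by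
          refine sum_le_sum fun i _ => ?_
          split_ifs with h
          · rw [sliceAt_sub_of_mem f h, abs_mul, abs_two]
          · positivity
      _ = 2 * (∑ i, |∑ x : Str n, f (x ⊓ z) * bitSign (x i)|) * slice g zᶜ := by
          rw [mul_sum, sum_mul]
      _ ≤ 2 * (n * (slice f z / 40 + 2 ^ n * Real.exp (-(n / 3200 : ℝ)))) * slice g zᶜ := by
          gcongr
          exact level_one (fun x => f (x ⊓ z)) (fun _ => hf0 _) fun _ => hf1 _
      _ = n * (slice f z * slice g zᶜ / 20 +
            2 * 2 ^ n * Real.exp (-(n / 3200 : ℝ)) * slice g zᶜ) := by ring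
      _ ≤ n * (slice f z * slice g zᶜ / 20 +
            2 * 2 ^ n * Real.exp (-(n / 3200 : ℝ)) * 2 ^ n) := by
          gcongr
          exact slice_le hg1 _
      _ = _ := by ring
  refine (sum_le_sum fun z _ => key z).trans (le_of_eq ?_)
  rw [← mul_sum, sum_add_distrib, ← sum_div]
  simp only [sum_const, card_univ, Fintype.card_pi, Fintype.card_bool, prod_const,
    Fintype.card_fin, nsmul_eq_mul]
  push_cast
  ring

theorem sum_eq_two_mul_of_invariant (i : Fin n) (b : Bool) {u : Str n → ℝ}
    (hu : ∀ z, u (Function.update z i b) = u z) :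
    ∑ z, u z = 2 * ∑ z, if z i = b then u z else 0 := by
  rw [← sum_update]
  exact sum_congr rfl fun z _ => (hu z).symm

theorem sum_compl (u : Str n → ℝ) : ∑ z, u zᶜ = ∑ z, u z :=
  Equiv.sum_comp (compl_involutive (α := Str n)).toPerm u

/-- If rows and columns are nearly independent of the membership of `i`, then putting `i` into
both sets hardly decreases the weight of the rectangle. -/
theorem sum_slice_mul_le (f g : Str n → ℝ) (hf0 : ∀ x, 0 ≤ f x) (hg0 : ∀ x, 0 ≤ g x)
    (i : Fin n) :
    ∑ z, slice f z * slice g zᶜ - 5 / 2 * (rowLoss f g i + rowLoss g f i) ≤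
      ∑ z, sliceAt f i true z * sliceAt g i true zᶜ := by
  -- `F b`, `G b` are the weights of the rows and columns with the membership of `i` given by `b`.
  set F : Bool → Str n → ℝ := fun b z => sliceAt f i b z with hF
  set G : Bool → Str n → ℝ := fun b z => sliceAt g i b zᶜ with hG
  have hFi : ∀ b c z, F b (Function.update z i c) = F b z := fun b c z => sliceAt_update f i b c z
  have hGi : ∀ b c z, G b (Function.update z i c) = G b z := fun b c z => by
    simp only [hG, compl_update, sliceAt_update]
  have hFn : ∀ b z, 0 ≤ F b z := fun b z => sliceAt_nonneg hf0 i b z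
  have hGn : ∀ b z, 0 ≤ G b z := fun b z => sliceAt_nonneg hg0 i b zᶜ
  have e1 : rowLoss f g i = ∑ z : Str n, if z i = true then
      |F false z - F true z| * G false z else 0 := by
    refine sum_congr rfl fun z _ => ?_
    split_ifs with h
    · rw [slice_of_not_mem g (i := i) (z := zᶜ) (by simp [h])]
    · rfl
  have e2 : rowLoss g f i = ∑ z : Str n, if z i = false then
      |G false z - G true z| * F false z else 0 := by
    unfold rowLoss
    rw [← sum_compl]
    refine sum_congr rfl fun z _ => ?_
    rw [compl_compl]
    cases h : z i
    · rw [slice_of_not_mem f h]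
      simp [h, hF, hG]
    · simp [h]
  have e3 : ∑ z, |F false z - F true z| * G false z = 2 * rowLoss f g i := by
    rw [e1]
    exact sum_eq_two_mul_of_invariant i true fun z => by simp only [hFi, hGi]
  have e4 : ∑ z, |G false z - G true z| * F false z = 2 * rowLoss g f i := by
    rw [e2]
    exact sum_eq_two_mul_of_invariant i false fun z => by simp only [hFi, hGi]
  have i1 : ∑ z, slice f z * slice g zᶜ ≤
      ∑ z, F false z * G false z + 1 / 2 * (rowLoss f g i + rowLoss g f i) := by
    rw [e1, e2, ← sum_add_distrib, mul_sum, ← sum_add_distrib]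
    refine sum_le_sum fun z _ => ?_
    cases h : z i
    · rw [slice_of_not_mem f h, slice_of_mem g (i := i) (z := zᶜ) (by simp [h])]
      have h1 : G true z ≤ G false z + |G false z - G true z| := by
        linarith [neg_abs_le (G false z - G true z)]
      have h2 := mul_le_mul_of_nonneg_left h1 (hFn false z)
      simp only [hF, hG] at h2 ⊢
      simp
      linarith
    · rw [slice_of_mem f h, slice_of_not_mem g (i := i) (z := zᶜ) (by simp [h])]
      have h1 : F true z ≤ F false z + |F false z - F true z| := by
        linarith [neg_abs_le (F false z - F true z)]
      have h2 := mul_le_mul_of_nonneg_right h1 (hGn false z)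
      simp only [hF, hG] at h2 ⊢
      simp
      linarith
  have i2 : ∑ z, F false z * G false z - (2 * rowLoss f g i + 2 * rowLoss g f i) ≤
      ∑ z, F true z * G true z := by
    rw [← e3, ← e4, ← sum_add_distrib, ← sum_sub_distrib]
    refine sum_le_sum fun z _ => ?_
    have a0 := hFn false z
    have a1 := hFn true z
    have b0 := hGn false z
    have b1 := hGn true z
    generalize F false z = p at *
    generalize F true z = q at *
    generalize G false z = r at *
    generalize G true z = t at *
    -- `u v ≥ 1 - (1 - u)⁺ - (1 - v)⁺` for the ratios `u = q / p` and `v = t / r`.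
    rcases le_total p q with h | h <;> rcases le_total r t with h' | h'
    · nlinarith [abs_nonneg (p - q), abs_nonneg (r - t), mul_le_mul h h' b0 a1,
        mul_nonneg (abs_nonneg (p - q)) b0, mul_nonneg (abs_nonneg (r - t)) a0]
    · rw [abs_of_nonneg (sub_nonneg.2 h')]
      nlinarith [mul_nonneg (abs_nonneg (p - q)) b0, mul_le_mul_of_nonneg_right h b1]
    · rw [abs_of_nonneg (sub_nonneg.2 h)]
      nlinarith [mul_nonneg (abs_nonneg (r - t)) a0, mul_le_mul_of_nonneg_left h' a1]
    · rw [abs_of_nonneg (sub_nonneg.2 h), abs_of_nonneg (sub_nonneg.2 h')]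
      nlinarith [mul_nonneg (sub_nonneg.2 h) (sub_nonneg.2 h')]
  linarith

/-- Razborov's corruption lemma, in unnormalized form: the weight of a rectangle `f ⊗ g` under the
distribution on uniquely intersecting pairs is at least `3 / 4` of its weight under the
distribution on disjoint pairs, up to an exponentially small term. -/
theorem corruption_sum {f g : Str n → ℝ} (hf0 : ∀ x, 0 ≤ f x) (hf1 : ∀ x, f x ≤ 1)
    (hg0 : ∀ x, 0 ≤ g x) (hg1 : ∀ x, g x ≤ 1) :
    n * (3 / 4 * ∑ z, slice f z * slice g zᶜ - 10 * (2 ^ n) ^ 3 * Real.exp (-(n / 3200 : ℝ))) ≤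
      ∑ i, ∑ z, sliceAt f i true z * sliceAt g i true zᶜ := by
  have h1 := sum_le_sum fun i (_ : i ∈ univ) => sum_slice_mul_le f g hf0 hg0 i
  rw [sum_sub_distrib, ← mul_sum, sum_add_distrib] at h1
  simp only [sum_const, card_univ, Fintype.card_fin, nsmul_eq_mul] at h1
  have h2 := sum_rowLoss_le hf0 hf1 hg0 hg1
  have h3 := sum_rowLoss_le hg0 hg1 hf0 hf1
  have h4 : ∑ z, slice g z * slice f zᶜ = ∑ z, slice f z * slice g zᶜ := by
    rw [← sum_compl]
    exact sum_congr rfl fun z _ => by rw [compl_compl, mul_comm]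
  rw [h4] at h3
  linarith

end Cube

/-! ### The corruption property -/

open Classical in
/-- The distribution of `T ω` for uniformly distributed `ω`. -/
noncomputable def unifMap {Ω V : Type} [Fintype Ω] (T : Ω → V) (p : V) : ℝ :=
  (∑ ω, if T ω = p then 1 else 0) / Fintype.card Ω

theorem unifMap_mem_stdSimplex {Ω V : Type} [Fintype Ω] [Nonempty Ω] [Fintype V] (T : Ω → V) :
    unifMap T ∈ stdSimplex ℝ V := by
  classical
  refine ⟨fun p => div_nonneg (sum_nonneg fun ω _ => by split_ifs <;> norm_num)
    (Nat.cast_nonneg _), ?_⟩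
  unfold unifMap
  rw [← sum_div, sum_comm]
  simp

theorem unifMap_eq_zero {Ω V : Type} [Fintype Ω] {T : Ω → V} {p : V} (h : ∀ ω, T ω ≠ p) :
    unifMap T p = 0 := by
  simp [unifMap, h]

open Classical in
theorem mass_unifMap {X Y Ω : Type} [Fintype Ω] (T : Ω → X × Y) (S : Finset (X × Y)) :
    mass (unifMap T) S = (∑ ω, if T ω ∈ S then 1 else 0) / Fintype.card Ω := by
  unfold mass unifMap
  rw [← sum_div, sum_comm]
  congr 1
  refine sum_congr rfl fun ω _ => ?_
  by_cases h : T ω ∈ S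
  · rw [sum_eq_single_of_mem (T ω) h, if_pos rfl, if_pos h]
    exact fun p _ hp => if_neg hp.symm
  · rw [if_neg h]
    refine sum_eq_zero fun p hp => if_neg ?_
    rintro rfl
    exact h hp

section Corruption

variable {X Y : Type} [Fintype X] [Fintype Y]

/-- `f` has the corruption property with additive error `η`: there are distributions `α` on the
1-inputs and `β` on the 0-inputs such that `β(R) ≥ 3/4 α(R) - η` for every rectangle `R`. -/
def HasCorruption (f : X → Y → Bool) (η : ℝ) : Prop :=
  ∃ α ∈ stdSimplex ℝ (X × Y), ∃ β ∈ stdSimplex ℝ (X × Y),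
    (∀ p, f p.1 p.2 = false → α p = 0) ∧ (∀ p, f p.1 p.2 = true → β p = 0) ∧
      ∀ (A : Finset X) (B : Finset Y), 3 / 4 * mass α (A ×ˢ B) - η ≤ mass β (A ×ˢ B)

theorem DISJ_eq_true {n : ℕ} {x y : Str n} :
    DISJ n x y = true ↔ ∀ i, ¬(x i = true ∧ y i = true) := by
  simp [DISJ, imp_iff_not_or]

theorem DISJ_inf_compl {n : ℕ} (x y z : Str n) : DISJ n (x ⊓ z) (y ⊓ zᶜ) = true := by
  rw [DISJ_eq_true]
  intro i
  simp only [Pi.inf_apply, Pi.compl_apply]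
  cases z i <;> simp

theorem DISJ_update {n : ℕ} (x y : Str n) (i : Fin n) :
    DISJ n (Function.update x i true) (Function.update y i true) = false := by
  rw [← Bool.not_eq_true, DISJ_eq_true]
  exact fun h => h i (by simp)

/-- Functions that contain set disjointness as a submatrix have the corruption property. -/
theorem hasCorruption_of_disj {n : ℕ} (hn : 0 < n) (f : X → Y → Bool) (φ : Str n → X)
    (ψ : Str n → Y) (hf : ∀ x y, f (φ x) (ψ y) = DISJ n x y) :
    HasCorruption f (10 * Real.exp (-(n / 3200 : ℝ))) := by
  classical
  have : Nonempty (Fin n) := ⟨⟨0, hn⟩⟩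
  -- `(x ∧ z, y ∧ ¬ z)` for uniform `x, y, z` is disjoint; adding a common element `i` makes it
  -- intersecting.
  set S : Str n × Str n × Str n → X × Y := fun ω => (φ (ω.2.1 ⊓ ω.1), ψ (ω.2.2 ⊓ ω.1ᶜ)) with hS
  set T : Fin n × Str n × Str n × Str n → X × Y := fun ω =>
    (φ (Function.update (ω.2.2.1 ⊓ ω.2.1) ω.1 true),
      ψ (Function.update (ω.2.2.2 ⊓ ω.2.1ᶜ) ω.1 true)) with hT
  refine ⟨unifMap S, unifMap_mem_stdSimplex S, unifMap T, unifMap_mem_stdSimplex T, ?_, ?_, ?_⟩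
  · intro p hp
    refine unifMap_eq_zero ?_
    rintro ω rfl
    simp [hS, hf, DISJ_inf_compl] at hp
  · intro p hp
    refine unifMap_eq_zero ?_
    rintro ω rfl
    simp [hT, hf, DISJ_update] at hp
  intro A B
  rw [mass_unifMap, mass_unifMap]
  set a : Str n → ℝ := fun x => if φ x ∈ A then 1 else 0 with ha
  set b : Str n → ℝ := fun y => if ψ y ∈ B then 1 else 0 with hb
  have hab : ∀ x y, (if (φ x, ψ y) ∈ A ×ˢ B then (1 : ℝ) else 0) = a x * b y := by
    intro x y
    simp only [mem_product, ha, hb]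
    split_ifs <;> simp_all
  have e1 : (∑ ω, if S ω ∈ A ×ˢ B then (1 : ℝ) else 0) = ∑ z, slice a z * slice b zᶜ := by
    rw [Fintype.sum_prod_type]
    refine sum_congr rfl fun z _ => ?_
    rw [Fintype.sum_prod_type, slice, slice, sum_mul_sum]
    exact sum_congr rfl fun x _ => sum_congr rfl fun y _ => hab _ _
  have e2 : (∑ ω, if T ω ∈ A ×ˢ B then (1 : ℝ) else 0) =
      ∑ i, ∑ z, sliceAt a i true z * sliceAt b i true zᶜ := by
    rw [Fintype.sum_prod_type]
    refine sum_congr rfl fun i _ => ?_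
    rw [Fintype.sum_prod_type]
    refine sum_congr rfl fun z _ => ?_
    rw [Fintype.sum_prod_type, sliceAt, sliceAt, sum_mul_sum]
    exact sum_congr rfl fun x _ => sum_congr rfl fun y _ => hab _ _
  have key := corruption_sum (f := a) (g := b) (fun x => by simp only [ha]; split_ifs <;> norm_num)
    (fun x => by simp only [ha]; split_ifs <;> norm_num)
    (fun x => by simp only [hb]; split_ifs <;> norm_num)
    (fun x => by simp only [hb]; split_ifs <;> norm_num)
  rw [e1, e2]
  have hn' : (0 : ℝ) < n := Nat.cast_pos.2 hn
  simp only [Fintype.card_prod, Fintype.card_pi, Fintype.card_bool, prod_const, card_univ,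
    Fintype.card_fin]
  push_cast
  rw [le_div_iff₀ (by positivity)]
  refine le_trans (le_of_eq ?_) key
  field_simp

end Corruption

/-! ### The rectangle bound -/

section Rectangles

variable {X Y : Type} [Fintype X] [Fintype Y]

theorem mass_nonneg {μ : X × Y → ℝ} (hμ : μ ∈ stdSimplex ℝ (X × Y)) (S : Finset (X × Y)) :
    0 ≤ mass μ S :=
  sum_nonneg fun p _ => hμ.1 p

theorem mass_le_one {μ : X × Y → ℝ} (hμ : μ ∈ stdSimplex ℝ (X × Y)) (S : Finset (X × Y)) :
    mass μ S ≤ 1 :=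
  (sum_le_univ_sum_of_nonneg hμ.1).trans hμ.2.le

theorem mass_le_size {μ : X × Y → ℝ} (hμ : μ ∈ stdSimplex ℝ (X × Y)) {ε : ℝ} {f : X → Y → Bool}
    {v : Bool} {R : Finset (X × Y)} (hR : IsRectangle R) (he : err f μ R v ≤ ε) :
    mass μ R ≤ size μ ε f v :=
  le_csSup ⟨1, by rintro _ ⟨R, -, -, rfl⟩; exact mass_le_one hμ R⟩ ⟨R, hR, he, rfl⟩

/-- For a balanced distribution some 1-input has non-negligible weight, and as a rectangle it has
no error. -/
theorem le_size_of_isBalanced {μ : X × Y → ℝ} {f : X → Y → Bool} (hμ : IsBalanced (1 / 4) f μ) :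
    0 < Fintype.card (X × Y) ∧
      1 / (4 * Fintype.card (X × Y) : ℝ) ≤ size μ (1 / 4) f true := by
  have hpos : 0 < Fintype.card (X × Y) := by
    rw [Fintype.card_pos_iff]
    by_contra h
    rw [not_nonempty_iff] at h
    have := hμ.1.2
    simp at this
  refine ⟨hpos, ?_⟩
  have hpos' : (0 : ℝ) < Fintype.card (X × Y) := Nat.cast_pos.2 hpos
  obtain ⟨p, hp1, hp2⟩ : ∃ p : X × Y, f p.1 p.2 = true ∧
      1 / (4 * Fintype.card (X × Y) : ℝ) ≤ μ p := by
    by_contra! hcon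
    have h1 := (hμ.2 true).1
    have h2 : mass μ (univ.filter fun p => f p.1 p.2 = true) < 1 / 4 := by
      have hne : (univ.filter fun p : X × Y => f p.1 p.2 = true).Nonempty := by
        rw [nonempty_iff_ne_empty]
        intro h
        rw [h] at h1
        norm_num [mass] at h1
      calc mass μ (univ.filter fun p => f p.1 p.2 = true)
          < ∑ _p ∈ univ.filter fun p : X × Y => f p.1 p.2 = true,
              1 / (4 * Fintype.card (X × Y) : ℝ) :=
            sum_lt_sum_of_nonempty hne fun p hp => hcon p (mem_filter.1 hp).2
        _ ≤ ∑ _p : X × Y, 1 / (4 * Fintype.card (X × Y) : ℝ) :=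
            sum_le_univ_sum_of_nonneg fun _ => by positivity
        _ = 1 / 4 := by
            rw [sum_const, card_univ, nsmul_eq_mul]
            field_simp
    linarith
  refine hp2.trans ?_
  have h3 := mass_le_size hμ.1 (ε := 1 / 4) (f := f) (v := true) (R := {p})
    ⟨{p.1}, {p.2}, by simp⟩ (by
      have : ({p} : Finset (X × Y)).filter (fun p => f p.1 p.2 = !true) = ∅ := by
        simp [filter_singleton, hp1]
      rw [err, this]
      norm_num [mass])
  simpa [mass] using h3

/-- The supremum in the definition of `bound1` is over a bounded set. -/
theorem le_bound1 {f : X → Y → Bool} {μ : X × Y → ℝ} (hμ : IsBalanced (1 / 4) f μ) :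
    Real.logb 2 (1 / size μ (1 / 4) f true) ≤ bound1 f := by
  refine le_csSup ⟨Real.logb 2 (4 * Fintype.card (X × Y)), ?_⟩ ⟨μ, hμ, rfl⟩
  rintro _ ⟨ν, hν, rfl⟩
  obtain ⟨h0, h1⟩ := le_size_of_isBalanced hν
  have h0' : (0 : ℝ) < Fintype.card (X × Y) := Nat.cast_pos.2 h0
  have h2 : (0 : ℝ) < 1 / (4 * Fintype.card (X × Y)) := by positivity
  refine Real.logb_le_logb_of_le (by norm_num) (one_div_pos.2 (h2.trans_le h1)) ?_
  calc _ ≤ 1 / (1 / (4 * Fintype.card (X × Y) : ℝ)) := one_div_le_one_div_of_le h2 h1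
    _ = _ := one_div_one_div _

/-- Under the mixture of the two distributions of the corruption property, rectangles with error
at most `1/4` are small. -/
theorem HasCorruption.le_bound1 {f : X → Y → Bool} {η : ℝ} (hf : HasCorruption f η) :
    ∃ P : ℝ, 1 ≤ 2 * η * P ∧ Real.logb 2 P ≤ bound1 f := by
  obtain ⟨α, hα, β, hβ, hα0, hβ0, hR⟩ := hf
  set μ : X × Y → ℝ := fun p => (α p + β p) / 2 with hμdef
  have hmass : ∀ S, mass μ S = (mass α S + mass β S) / 2 := fun S => by
    simp only [mass, hμdef]
    rw [← sum_div, sum_add_distrib]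
  have hα' : ∀ S : Finset (X × Y), mass α (S.filter fun p => f p.1 p.2 = false) = 0 := fun S =>
    sum_eq_zero fun p hp => hα0 p (mem_filter.1 hp).2
  have hβ' : ∀ S : Finset (X × Y), mass β (S.filter fun p => f p.1 p.2 = true) = 0 := fun S =>
    sum_eq_zero fun p hp => hβ0 p (mem_filter.1 hp).2
  have hsplit : ∀ (ν : X × Y → ℝ) (S : Finset (X × Y)),
      mass ν (S.filter fun p => f p.1 p.2 = true) + mass ν (S.filter fun p => f p.1 p.2 = false) =
        mass ν S := fun ν S => by
    unfold mass
    rw [← sum_filter_add_sum_filter_not S (fun p => f p.1 p.2 = true)]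
    simp only [Bool.not_eq_true]
  have hα1 : mass α univ = 1 := hα.2
  have hβ1 : mass β univ = 1 := hβ.2
  have hμ : IsBalanced (1 / 4) f μ := by
    refine ⟨⟨fun p => ?_, ?_⟩, fun v => ?_⟩
    · have := hα.1 p
      have := hβ.1 p
      simp only [hμdef]
      positivity
    · have := hmass univ
      rw [hα1, hβ1] at this
      simpa [mass] using this
    · have h1 := hsplit α univ
      have h2 := hsplit β univ
      rw [hα', hα1] at h1
      rw [hβ', hβ1] at h2
      rw [hmass]
      cases v
      · rw [hα']
        constructor <;> linarith
      · rw [hβ']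
        constructor <;> linarith
  have hsize : size μ (1 / 4) f true ≤ 2 * η := by
    refine csSup_le ⟨_, ∅, ⟨∅, ∅, by simp⟩, by norm_num [err, mass], rfl⟩ ?_
    rintro _ ⟨R, ⟨A, B, rfl⟩, he, rfl⟩
    have hc := hR A B
    have hs := hsplit β (A ×ˢ B)
    rw [hβ', zero_add] at hs
    have hm := hmass (A ×ˢ B)
    have hb : mass β (A ×ˢ B) / 2 ≤ 1 / 4 * mass μ (A ×ˢ B) := by
      rcases (mass_nonneg hμ.1 (A ×ˢ B)).eq_or_lt with h0 | h0
      · have := mass_nonneg hα (A ×ˢ B)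
        linarith
      · rw [err, div_le_iff₀ h0, hmass, Bool.not_true, hα', hs] at he
        linarith
    have hα2 := mass_nonneg hα (A ×ˢ B)
    linarith
  obtain ⟨h0, h1⟩ := le_size_of_isBalanced hμ
  have h0' : (0 : ℝ) < Fintype.card (X × Y) := Nat.cast_pos.2 h0
  have h2 : 0 < size μ (1 / 4) f true := lt_of_lt_of_le (by positivity) h1
  refine ⟨1 / size μ (1 / 4) f true, ?_, CommCx.le_bound1 hμ⟩
  rw [mul_one_div, le_div_iff₀ h2, one_mul]
  exact hsize

end Rectangles

/-! ### Combinations of rectangles -/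

section RectSum

variable {X Y : Type}

open Classical in
/-- The indicator function of the rectangle `A × B`. -/
noncomputable def rectInd (A : Finset X) (B : Finset Y) (x : X) (y : Y) : ℝ :=
  if x ∈ A ∧ y ∈ B then 1 else 0

/-- `h` is a nonnegative combination of indicator functions of rectangles with total weight at
most `W`. -/
def IsRectSum (W : ℝ) (h : X → Y → ℝ) : Prop :=
  ∃ (ι : Type) (_ : Fintype ι) (w : ι → ℝ) (A : ι → Finset X) (B : ι → Finset Y),
    (∀ i, 0 ≤ w i) ∧ ∑ i, w i ≤ W ∧ ∀ x y, h x y = ∑ i, w i * rectInd (A i) (B i) x y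

theorem isRectSum_rectInd (A : Finset X) (B : Finset Y) : IsRectSum 1 (rectInd A B) :=
  ⟨Unit, inferInstance, fun _ => 1, fun _ => A, fun _ => B, fun _ => zero_le_one, by simp,
    fun x y => by simp⟩

theorem IsRectSum.mono {W W' : ℝ} {h : X → Y → ℝ} (hh : IsRectSum W h) (hW : W ≤ W') :
    IsRectSum W' h := by
  obtain ⟨ι, hι, w, A, B, h0, h1, h2⟩ := hh
  exact ⟨ι, hι, w, A, B, h0, h1.trans hW, h2⟩

theorem IsRectSum.smul {W : ℝ} {h : X → Y → ℝ} (hh : IsRectSum W h) {c : ℝ} (hc : 0 ≤ c) :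
    IsRectSum (c * W) fun x y => c * h x y := by
  obtain ⟨ι, hι, w, A, B, h0, h1, h2⟩ := hh
  refine ⟨ι, hι, fun i => c * w i, A, B, fun i => mul_nonneg hc (h0 i), ?_, fun x y => ?_⟩
  · rw [← mul_sum]
    gcongr
  · dsimp only
    rw [h2, mul_sum]
    exact sum_congr rfl fun i _ => by ring

theorem IsRectSum.sum {κ : Type} [Fintype κ] {W : κ → ℝ} {h : κ → X → Y → ℝ}
    (hh : ∀ j, IsRectSum (W j) (h j)) : IsRectSum (∑ j, W j) fun x y => ∑ j, h j x y := by
  choose ι _ w A B h0 h1 h2 using hh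
  refine ⟨Σ j, ι j, inferInstance, fun i => w i.1 i.2, fun i => A i.1 i.2, fun i => B i.1 i.2,
    fun i => h0 _ _, ?_, fun x y => ?_⟩
  · rw [Fintype.sum_sigma]
    exact sum_le_sum fun j _ => h1 j
  · rw [Fintype.sum_sigma]
    exact sum_congr rfl fun j _ => h2 j x y

theorem IsRectSum.add {W W' : ℝ} {h h' : X → Y → ℝ} (hh : IsRectSum W h) (hh' : IsRectSum W' h') :
    IsRectSum (W + W') fun x y => h x y + h' x y := by
  have := IsRectSum.sum (κ := Bool) (W := fun b => if b then W else W')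
    (h := fun b => if b then h else h') (fun b => by cases b <;> simpa)
  simpa using this

theorem IsRectSum.mul {W W' : ℝ} {h h' : X → Y → ℝ} (hh : IsRectSum W h) (hh' : IsRectSum W' h') :
    IsRectSum (W * W') fun x y => h x y * h' x y := by
  classical
  obtain ⟨ι, hι, w, A, B, h0, h1, h2⟩ := hh
  obtain ⟨ι', hι', w', A', B', h0', h1', h2'⟩ := hh'
  refine ⟨ι × ι', inferInstance, fun i => w i.1 * w' i.2, fun i => A i.1 ∩ A' i.2,
    fun i => B i.1 ∩ B' i.2, fun i => mul_nonneg (h0 _) (h0' _), ?_, fun x y => ?_⟩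
  · rw [Fintype.sum_prod_type, ← sum_mul_sum]
    exact mul_le_mul h1 h1' (sum_nonneg fun i _ => h0' i)
      ((sum_nonneg fun i _ => h0 i).trans h1)
  · dsimp only
    rw [h2, h2', sum_mul_sum, Fintype.sum_prod_type]
    refine sum_congr rfl fun i _ => sum_congr rfl fun j _ => ?_
    simp only [rectInd, mem_inter]
    split_ifs <;> simp_all

variable [Fintype X] [Fintype Y]

theorem IsRectSum.pow {W : ℝ} {h : X → Y → ℝ} (hh : IsRectSum W h) (m : ℕ) :
    IsRectSum (W ^ m) fun x y => h x y ^ m := by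
  induction m with
  | zero =>
    have h1 : rectInd (univ : Finset X) (univ : Finset Y) = fun _ _ => 1 := by
      ext x y
      simp [rectInd]
    simpa [h1] using isRectSum_rectInd (univ : Finset X) (univ : Finset Y)
  | succ m ih => simpa only [pow_succ] using ih.mul hh

/-- The corruption inequality for rectangles extends linearly to combinations of rectangles. If
such a combination is at least `u` on 1-inputs and at most `v` on 0-inputs, with `v` well below
`u`, then its weight is exponentially large. -/
theorem HasCorruption.le_of_isRectSum {f : X → Y → Bool} {η W u v : ℝ} (hf : HasCorruption f η)
    (hη : 0 ≤ η) {h : X → Y → ℝ} (hh : IsRectSum W h) (hu : ∀ x y, f x y = true → u ≤ h x y)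
    (hv : ∀ x y, f x y = false → h x y ≤ v) : 3 / 4 * u - W * η ≤ v := by
  classical
  obtain ⟨α, hα, β, hβ, hα0, hβ0, hR⟩ := hf
  obtain ⟨ι, hι, w, A, B, h0, h1, h2⟩ := hh
  have hE : ∀ ν : X × Y → ℝ, ∑ p, ν p * h p.1 p.2 = ∑ i, w i * mass ν (A i ×ˢ B i) := by
    intro ν
    simp_rw [h2, mul_sum]
    rw [sum_comm]
    refine sum_congr rfl fun i _ => ?_
    rw [mass, mul_sum, ← sum_filter_add_sum_filter_not univ (fun p : X × Y => p ∈ A i ×ˢ B i)]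
    rw [sum_eq_zero (s := univ.filter fun p : X × Y => ¬ p ∈ A i ×ˢ B i), add_zero]
    · refine sum_congr (by ext; simp) fun p hp => ?_
      rw [mem_product] at hp
      simp only [rectInd, hp, and_self, if_true]
      ring
    · intro p hp
      rw [mem_filter, mem_product] at hp
      simp [rectInd, hp.2]
  have e1 : u ≤ ∑ p, α p * h p.1 p.2 := by
    calc u = ∑ p, α p * u := by rw [← sum_mul, hα.2, one_mul]
      _ ≤ _ := sum_le_sum fun p _ => by
        cases hp : f p.1 p.2
        · simp [hα0 p hp]
        · exact mul_le_mul_of_nonneg_left (hu _ _ hp) (hα.1 p)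
  have e2 : ∑ p, β p * h p.1 p.2 ≤ v := by
    calc _ ≤ ∑ p, β p * v := sum_le_sum fun p _ => by
          cases hp : f p.1 p.2
          · exact mul_le_mul_of_nonneg_left (hv _ _ hp) (hβ.1 p)
          · simp [hβ0 p hp]
      _ = v := by rw [← sum_mul, hβ.2, one_mul]
  have e3 : 3 / 4 * ∑ i, w i * mass α (A i ×ˢ B i) - (∑ i, w i) * η ≤
      ∑ i, w i * mass β (A i ×ˢ B i) := by
    rw [mul_sum, sum_mul, ← sum_sub_distrib]
    refine sum_le_sum fun i _ => ?_
    have := mul_le_mul_of_nonneg_left (hR (A i) (B i)) (h0 i)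
    linarith
  rw [hE] at e1 e2
  have := mul_le_mul_of_nonneg_right h1 hη
  linarith

end RectSum

/-! ### Uniform threshold covers -/

section UniformThreshold

variable {X Y : Type} [Fintype X] [Fintype Y]

/-- The number of rectangles that contain an input is at least `2 s` on 1-inputs and at most `s` on
0-inputs, and `3 / 4 * (2 * s)` exceeds `s`. -/
theorem HasCorruption.le_of_isOneSidedUTCover {f : X → Y → Bool} {η : ℝ} (hf : HasCorruption f η)
    (hη : 0 ≤ η) {s P : ℕ} (hs : 1 ≤ s) {R : Fin P → Finset (X × Y)}
    (hR : IsOneSidedUTCover s (2 * s) f P R) : 1 ≤ 2 * η * P := by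
  classical
  obtain ⟨hrect, hcov⟩ := hR
  choose A B hAB using hrect
  have h1 : IsRectSum (P : ℝ) fun x y => ∑ i, rectInd (A i) (B i) x y := by
    simpa using IsRectSum.sum fun i => isRectSum_rectInd (A i) (B i)
  have h2 : ∀ x y, ∑ i, rectInd (A i) (B i) x y =
      ((univ.filter fun i => (x, y) ∈ R i).card : ℝ) := by
    intro x y
    rw [card_filter]
    push_cast
    refine sum_congr rfl fun i _ => ?_
    simp [rectInd, hAB, mem_product]
  have h3 := hf.le_of_isRectSum hη h1 (u := (2 * s : ℕ)) (v := s)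
    (fun x y hxy => by
      rw [h2, Nat.cast_le]
      convert (hcov x y).1 hxy)
    (fun x y hxy => by
      rw [h2, Nat.cast_le]
      convert (hcov x y).2 hxy)
  push_cast at h3
  have hs' : (1 : ℝ) ≤ s := by exact_mod_cast hs
  linarith

/-- Covers exist: take every 1-input `t` times. -/
theorem exists_isOneSidedUTCover (f : X → Y → Bool) (s t : ℕ) :
    ∃ (P : ℕ) (R : Fin P → Finset (X × Y)), IsOneSidedUTCover s t f P R := by
  classical
  let e := Fintype.equivFin ({p : X × Y // f p.1 p.2 = true} × Fin t)
  refine ⟨_, fun i => {((e.symm i).1 : X × Y)}, fun i => ⟨{(e.symm i).1.1.1}, {(e.symm i).1.1.2},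
    by simp⟩, fun x y => ⟨fun h => ?_, fun h => ?_⟩⟩
  · have hinj : Function.Injective fun j : Fin t => e (⟨(x, y), h⟩, j) := fun j j' hj => by
      simpa using hj
    have hsub : univ.image (fun j : Fin t => e (⟨(x, y), h⟩, j)) ⊆
        univ.filter fun i => (x, y) ∈ ({((e.symm i).1 : X × Y)} : Finset (X × Y)) := by
      intro i hi
      obtain ⟨j, -, rfl⟩ := mem_image.1 hi
      simp
    have := card_le_card hsub
    rw [card_image_of_injective _ hinj, card_univ, Fintype.card_fin] at this
    convert this
  · rw [filter_false_of_mem, card_empty]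
    · exact Nat.zero_le s
    · intro i _ hi
      rw [mem_singleton] at hi
      have := (e.symm i).1.2
      rw [← hi, h] at this
      exact Bool.noConfusion this

theorem HasCorruption.le_UT1 {f : X → Y → Bool} {η : ℝ} (hf : HasCorruption f η)
    (hη : 0 ≤ η) {s : ℕ} (hs : 1 ≤ s) :
    ∃ P : ℝ, 1 ≤ 2 * η * P ∧ Real.logb 2 P ≤ UT1 s (2 * s) f := by
  obtain ⟨R, hR⟩ := Nat.sInf_mem (s := {P : ℕ | ∃ R : Fin P → Finset (X × Y),
    IsOneSidedUTCover s (2 * s) f P R}) (exists_isOneSidedUTCover f s (2 * s))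
  exact ⟨_, hf.le_of_isOneSidedUTCover hη hs hR, Nat.le_ceil _⟩

end UniformThreshold

/-! ### Merlin Arthur protocols -/

theorem MAProtocol.acceptProb_nonneg {X Y : Type} (M : MAProtocol X Y) (z : Fin M.k → Bool)
    (x : X) (y : Y) :
    0 ≤ M.acceptProb z x y :=
  ENNReal.toReal_nonneg

/-- Every function has a deterministic protocol, in which Alice goes through the possible inputs and
announces when hers is reached. -/
theorem exists_protocol {X Y : Type} [Fintype X] (f : X → Y → Bool) :
    ∃ π : Protocol X Y, ∀ x y, π.run x y = f x y := by
  classical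
  have : ∀ S : Finset X, ∃ π : Protocol X Y, ∀ x ∈ S, ∀ y, π.run x y = f x y := by
    intro S
    induction S using Finset.induction_on with
    | empty => exact ⟨.leaf true, by simp⟩
    | insert a S _ ih =>
      obtain ⟨π, hπ⟩ := ih
      refine ⟨.alice (fun x => decide (x = a)) π (.bob (f a) (.leaf false) (.leaf true)), ?_⟩
      intro x hx y
      by_cases hxa : x = a
      · subst hxa
        cases h : f x y <;> simp [Protocol.run, h]
      · simpa [Protocol.run, hxa] using hπ x ((mem_insert.1 hx).resolve_left hxa) y
  obtain ⟨π, hπ⟩ := this univ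
  exact ⟨π, fun x y => hπ x (mem_univ x) y⟩

/-- Some protocol computes `f`, so that the infimum in the definition of `MA f` is attained. -/
theorem exists_computes_costLE {X Y : Type} [Fintype X] (f : X → Y → Bool) :
    ∃ (c : ℕ) (M : MAProtocol X Y), M.Computes (1 / 4) f ∧ M.CostLE c := by
  obtain ⟨π, hπ⟩ := exists_protocol f
  refine ⟨π.depth, ⟨0, fun _ => PMF.pure π⟩, fun x y => ⟨fun h => ⟨fun _ => false, ?_⟩,
    fun h z => ?_⟩, fun z ρ hρ => ?_⟩
  · simp only [MAProtocol.acceptProb, PMF.pure_map, hπ, h, PMF.pure_apply_self]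
    norm_num
  · simp only [MAProtocol.acceptProb, PMF.pure_map, hπ, h, PMF.pure_apply]
    norm_num
  · rw [PMF.support_pure, Set.mem_singleton_iff] at hρ
    simp [hρ]

section MerlinArthurBound

variable {X Y : Type} [Fintype X] [Fintype Y]

/-- The inputs accepted by a protocol of depth `d` are a disjoint union of at most `2 ^ d`
rectangles. -/
theorem Protocol.isRectSum (π : Protocol X Y) :
    IsRectSum (2 ^ π.depth) fun x y => if π.run x y = true then 1 else 0 := by
  classical
  -- At an inner node, each subprotocol is restricted to the inputs that reach it.
  have key : ∀ (p0 p1 : Protocol X Y) (A0 A1 : Finset X) (B0 B1 : Finset Y)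
      (g : X → Y → Bool),
      IsRectSum (2 ^ p0.depth) (fun x y => if p0.run x y = true then 1 else 0) →
      IsRectSum (2 ^ p1.depth) (fun x y => if p1.run x y = true then 1 else 0) →
      (∀ x y, (if g x y = true then (1 : ℝ) else 0) =
        rectInd A1 B1 x y * (if p1.run x y = true then 1 else 0) +
        rectInd A0 B0 x y * (if p0.run x y = true then 1 else 0)) →
      IsRectSum (2 ^ (1 + max p0.depth p1.depth)) fun x y => if g x y = true then 1 else 0 := by
    intro p0 p1 A0 A1 B0 B1 g h0 h1 hg
    simp_rw [hg]
    refine (((isRectSum_rectInd A1 B1).mul h1).add ((isRectSum_rectInd A0 B0).mul h0)).mono ?_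
    rw [pow_add]
    have e0 : (2 : ℝ) ^ p0.depth ≤ 2 ^ max p0.depth p1.depth :=
      pow_le_pow_right₀ one_le_two (le_max_left _ _)
    have e1 : (2 : ℝ) ^ p1.depth ≤ 2 ^ max p0.depth p1.depth :=
      pow_le_pow_right₀ one_le_two (le_max_right _ _)
    linarith
  induction π with
  | leaf b =>
    have h : (fun (x : X) (y : Y) => if (Protocol.leaf b : Protocol X Y).run x y = true then
        (1 : ℝ) else 0) = rectInd (univ.filter fun _ => b = true) univ := by
      ext x y
      cases b <;> simp [Protocol.run, rectInd]
    rw [h]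
    exact (isRectSum_rectInd _ _).mono (by simp [Protocol.depth])
  | alice q p0 p1 h0 h1 =>
    refine key p0 p1 (univ.filter fun x => q x = false)
      (univ.filter fun x => q x = true) univ univ _ h0 h1 fun x y => ?_
    cases hq : q x <;> simp [Protocol.run, rectInd, hq]
  | bob q p0 p1 h0 h1 =>
    refine key p0 p1 univ univ (univ.filter fun y => q y = false)
      (univ.filter fun y => q y = true) _ h0 h1 fun x y => ?_
    cases hq : q y <;> simp [Protocol.run, rectInd, hq]

/-- There are only finitely many functions of the inputs, so that the randomization over protocol
trees is a finite convex combination. -/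
theorem MAProtocol.isRectSum_acceptProb (M : MAProtocol X Y) {d : ℕ} (z : Fin M.k → Bool)
    (hd : ∀ π ∈ (M.rand z).support, π.depth ≤ d) : IsRectSum (2 ^ d) (M.acceptProb z) := by
  classical
  set Q : PMF (X → Y → Bool) := (M.rand z).map Protocol.run with hQ
  have hacc : ∀ x y, M.acceptProb z x y =
      ∑ h : X → Y → Bool, (Q h).toReal * if h x y = true then 1 else 0 := by
    intro x y
    have h1 : (M.rand z).map (fun π => π.run x y) = Q.map fun h => h x y := by
      rw [hQ, PMF.map_comp]
      rfl
    rw [MAProtocol.acceptProb, h1, PMF.map_apply, tsum_fintype, ENNReal.toReal_sum]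
    · refine sum_congr rfl fun h _ => ?_
      cases hh : h x y <;> simp
    · intro h _
      split_ifs
      · exact PMF.apply_ne_top Q h
      · exact ENNReal.zero_ne_top
  have hsum : ∑ h : X → Y → Bool, (Q h).toReal = 1 := by
    rw [← ENNReal.toReal_sum fun h _ => PMF.apply_ne_top Q h, ← tsum_fintype (L := .unconditional _),
      PMF.tsum_coe, ENNReal.toReal_one]
  have hrect : ∀ h : X → Y → Bool, IsRectSum ((Q h).toReal * 2 ^ d)
      fun x y => (Q h).toReal * if h x y = true then 1 else 0 := by
    intro h
    by_cases h0 : Q h = 0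
    · have := (isRectSum_rectInd (∅ : Finset X) (∅ : Finset Y)).smul le_rfl
      simpa [h0] using this
    · obtain ⟨π, hπ, rfl⟩ := (PMF.mem_support_map_iff _ _ _).1 ((PMF.mem_support_iff _ _).2 h0)
      exact (π.isRectSum.mono (pow_le_pow_right₀ one_le_two (hd π hπ))).smul ENNReal.toReal_nonneg
  have hfin := IsRectSum.sum hrect
  rw [← sum_mul, hsum, one_mul] at hfin
  have he : M.acceptProb z = fun x y =>
      ∑ h : X → Y → Bool, (Q h).toReal * if h x y = true then 1 else 0 := by
    funext x y
    exact hacc x y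
  rw [he]
  exact hfin

/-- The sum over all guesses `z` of the probability that `k + 1` independent runs on the guess `z`
all accept is a combination of rectangles. It separates 1-inputs from 0-inputs since `3 ^ (k + 1)`
exceeds the number of guesses. -/
theorem HasCorruption.le_of_computes {f : X → Y → Bool} {η : ℝ} (hf : HasCorruption f η)
    (hη : 0 ≤ η) {M : MAProtocol X Y} (hM : M.Computes (1 / 4) f) {c : ℕ} (hc : M.CostLE c) :
    1 ≤ 2 ^ ((c + 2) ^ 2) * η := by
  classical
  obtain ⟨d, rfl⟩ : ∃ d, c = M.k + d := by
    obtain ⟨π, hπ⟩ := (M.rand fun _ => false).support_nonempty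
    exact ⟨c - M.k, by have := hc _ π hπ; omega⟩
  set k := M.k with hk
  have h1 : IsRectSum (2 ^ k * (2 ^ d) ^ (k + 1))
      fun x y => ∑ z : Fin k → Bool, M.acceptProb z x y ^ (k + 1) := by
    have := IsRectSum.sum fun z : Fin k → Bool => (M.isRectSum_acceptProb (d := d) z
      fun π hπ => by have := hc z π hπ; omega).pow (k + 1)
    simpa using this
  have h2 := hf.le_of_isRectSum hη h1 (u := (3 / 4) ^ (k + 1)) (v := 2 ^ k * (1 / 4) ^ (k + 1))
    (fun x y hxy => by
      obtain ⟨z, hz⟩ := (hM x y).1 hxy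
      calc ((3 : ℝ) / 4) ^ (k + 1) ≤ M.acceptProb z x y ^ (k + 1) :=
            pow_le_pow_left₀ (by norm_num) (by linarith) _
        _ ≤ _ := single_le_sum (f := fun z => M.acceptProb z x y ^ (k + 1))
            (fun z _ => pow_nonneg (M.acceptProb_nonneg z x y) _) (mem_univ z))
    (fun x y hxy => by
      calc _ ≤ ∑ _z : Fin k → Bool, ((1 : ℝ) / 4) ^ (k + 1) := sum_le_sum fun z _ =>
            pow_le_pow_left₀ (M.acceptProb_nonneg z x y) ((hM x y).2 hxy z) _
        _ = _ := by simp)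
  have h3 : (1 : ℝ) ≤ 4 ^ (k + 1) * (2 ^ k * (2 ^ d) ^ (k + 1)) * η := by
    have e1 : (4 : ℝ) ^ (k + 1) * (3 / 4) ^ (k + 1) = 3 * 3 ^ k := by
      rw [← mul_pow, pow_succ]
      norm_num
      ring
    have e2 : (4 : ℝ) ^ (k + 1) * (1 / 4) ^ (k + 1) = 1 := by
      rw [← mul_pow]
      norm_num
    have e3 : (2 : ℝ) ^ k ≤ 3 ^ k := pow_le_pow_left₀ (by norm_num) (by norm_num) _
    have e4 : (1 : ℝ) ≤ 3 ^ k := one_le_pow₀ (by norm_num)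
    have e5 := mul_le_mul_of_nonneg_left h2 (by positivity : (0 : ℝ) ≤ 4 ^ (k + 1))
    rw [mul_sub, mul_left_comm, e1, mul_left_comm _ ((2 : ℝ) ^ k), e2, mul_one, ← mul_assoc] at e5
    linarith
  refine h3.trans (mul_le_mul_of_nonneg_right ?_ hη)
  have e6 : (4 : ℝ) ^ (k + 1) * (2 ^ k * (2 ^ d) ^ (k + 1)) =
      2 ^ (2 * (k + 1) + (k + d * (k + 1))) := by
    rw [← pow_mul, pow_add 2 (2 * (k + 1)), pow_add 2 k, pow_mul 2 2]
    norm_num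
  rw [e6]
  exact pow_le_pow_right₀ one_le_two (by nlinarith [Nat.zero_le (d * k)])

theorem HasCorruption.le_MA {f : X → Y → Bool} {η : ℝ} (hf : HasCorruption f η) (hη : 0 ≤ η) :
    1 ≤ 2 ^ ((MA f + 2) ^ 2) * η := by
  obtain ⟨M, hM, hc⟩ := Nat.sInf_mem (s := {c : ℕ | ∃ M : MAProtocol X Y,
    M.Computes (1 / 4) f ∧ M.CostLE c}) (exists_computes_costLE f)
  exact hf.le_of_computes hη hM hc

end MerlinArthurBound

/-! ### Corruption for `BOTH` and its negation -/

section Both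

variable {n : ℕ}

theorem hasCorruption_BOTH (hn : 0 < n) :
    HasCorruption (BOTH n) (10 * Real.exp (-(n / 3200 : ℝ))) :=
  hasCorruption_of_disj hn _ (fun x => (x, x, true)) (fun y => (y, y)) fun x y => by simp [BOTH]

theorem hasCorruption_neg_BOTH (hn : 0 < n) :
    HasCorruption (neg (BOTH n)) (10 * Real.exp (-(n / 3200 : ℝ))) :=
  hasCorruption_of_disj hn _ (fun x => (x, x, false)) (fun y => (y, y)) fun x y => by
    simp [BOTH, neg]

theorem le_logb_of_one_le {P : ℝ} (hn : 25600 ≤ n)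
    (hP : 1 ≤ 2 * (10 * Real.exp (-(n / 3200 : ℝ))) * P) : 1 / 6400 * n ≤ Real.logb 2 P := by
  have hn' : (25600 : ℝ) ≤ n := by exact_mod_cast hn
  have h1 : Real.exp (n / 3200 : ℝ) ≤ 20 * P := by
    have := mul_le_mul_of_nonneg_left hP (Real.exp_pos (n / 3200 : ℝ)).le
    rw [mul_one] at this
    refine this.trans (le_of_eq ?_)
    rw [Real.exp_neg]
    field_simp
    ring
  have h2 : (20 : ℝ) ≤ Real.exp (n / 6400 : ℝ) := by
    calc (20 : ℝ) ≤ 2.7 ^ 4 := by norm_num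
      _ ≤ Real.exp 1 ^ 4 := by
          gcongr
          linarith [Real.exp_one_gt_d9]
      _ = Real.exp 4 := by rw [← Real.exp_nat_mul]; norm_num
      _ ≤ _ := by gcongr; linarith
  have h3 : Real.exp (n / 6400 : ℝ) ≤ P := by
    have h4 : Real.exp (n / 3200 : ℝ) = Real.exp (n / 6400 : ℝ) * Real.exp (n / 6400 : ℝ) := by
      rw [← Real.exp_add]
      ring_nf
    have := mul_le_mul_of_nonneg_right h2 (Real.exp_pos (n / 6400 : ℝ)).le
    linarith
  have h5 : (n / 6400 : ℝ) ≤ Real.log P :=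
    (Real.le_log_iff_exp_le ((Real.exp_pos _).trans_le h3)).2 h3
  have h6 : (0 : ℝ) < Real.log 2 := Real.log_pos one_lt_two
  rw [Real.logb, le_div_iff₀ h6]
  have h7 : Real.log 2 ≤ 1 := by linarith [Real.log_two_lt_d9]
  have h8 : 1 / 6400 * (n : ℝ) * Real.log 2 ≤ 1 / 6400 * n * 1 := by gcongr
  linarith

theorem le_sqrt_of_one_le {c : ℕ} (hn : 102400 ≤ n)
    (hc : 1 ≤ 2 ^ ((c + 2) ^ 2) * (10 * Real.exp (-(n / 3200 : ℝ)))) :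
    1 / 160 * Real.sqrt n ≤ c := by
  have hn' : (102400 : ℝ) ≤ n := by exact_mod_cast hn
  have h1 : Real.exp (n / 3200 : ℝ) ≤ 10 * 2 ^ ((c + 2) ^ 2) := by
    have := mul_le_mul_of_nonneg_left hc (Real.exp_pos (n / 3200 : ℝ)).le
    rw [mul_one] at this
    refine this.trans (le_of_eq ?_)
    rw [Real.exp_neg]
    field_simp
  have h2 : (10 : ℝ) * 2 ^ ((c + 2) ^ 2) ≤ Real.exp (3 + ((c : ℝ) + 2) ^ 2) := by
    have e1 : (2 : ℝ) ^ ((c + 2) ^ 2) ≤ Real.exp 1 ^ ((c + 2) ^ 2) := by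
      gcongr
      linarith [Real.exp_one_gt_d9]
    have e2 : (10 : ℝ) ≤ Real.exp 3 := by
      calc (10 : ℝ) ≤ 2.7 ^ 3 := by norm_num
        _ ≤ Real.exp 1 ^ 3 := by
            gcongr
            linarith [Real.exp_one_gt_d9]
        _ = Real.exp 3 := by rw [← Real.exp_nat_mul]; norm_num
    rw [Real.exp_add]
    refine mul_le_mul e2 (e1.trans (le_of_eq ?_)) (by positivity) (Real.exp_pos _).le
    rw [← Real.exp_nat_mul]
    push_cast
    rw [mul_one]
  have h3 := Real.exp_le_exp.1 (h1.trans h2)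
  have h4 : Real.sqrt n ≤ 80 * (c + 2) := by
    rw [Real.sqrt_le_left (by positivity)]
    nlinarith
  have h5 : (320 : ℝ) ≤ Real.sqrt n := by
    rw [Real.le_sqrt (by norm_num) (by linarith)]
    linarith
  linarith

end Both

/-! ### A small approximate majority cover -/

section ApproxMajority

variable {n : ℕ}

/-- The string of the row input that is relevant if `a = v`. -/
def rowPart (v : Bool) (p : Str n × Str n × Bool) : Str n := if v then p.1 else p.2.1

/-- The string of the column input that is relevant if `a = v`. -/
def colPart (v : Bool) (q : Str n × Str n) : Str n := if v then q.1 else q.2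

theorem BOTH_eq (p : Str n × Str n × Bool) (q : Str n × Str n) :
    BOTH n p q = (DISJ n (rowPart p.2.2 p) (colPart p.2.2 q) == p.2.2) := by
  obtain ⟨x1, x2, a⟩ := p
  cases a <;> simp [BOTH, rowPart, colPart]

/-- The rectangle of all inputs with `a = v`. -/
def defaultRect (n : ℕ) (v : Bool) : Finset ((Str n × Str n × Bool) × (Str n × Str n)) :=
  (univ.filter fun p => p.2.2 = v) ×ˢ univ

/-- The rectangle of the inputs with `a = v` whose relevant strings intersect in `i`. The bit `b`
at position `j` of the irrelevant column string is prescribed, only to obtain many different such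
rectangles. -/
def interRect (v : Bool) (i j : Fin n) (b : Bool) :
    Finset ((Str n × Str n × Bool) × (Str n × Str n)) :=
  (univ.filter fun p => p.2.2 = v ∧ rowPart v p i = true) ×ˢ
    (univ.filter fun q => colPart v q i = true ∧ colPart (!v) q j = b)

theorem mem_defaultRect {v : Bool} {p : Str n × Str n × Bool} {q : Str n × Str n} :
    (p, q) ∈ defaultRect n v ↔ p.2.2 = v := by
  simp [defaultRect]

theorem mem_interRect {v : Bool} {i j : Fin n} {b : Bool} {p : Str n × Str n × Bool}
    {q : Str n × Str n} : (p, q) ∈ interRect v i j b ↔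
      (p.2.2 = v ∧ rowPart v p i = true) ∧ colPart v q i = true ∧ colPart (!v) q j = b := by
  simp [interRect]

theorem interRect_injective {v : Bool} {i : Fin n} {p : Str n × Str n × Bool} {q : Str n × Str n}
    (hp : p.2.2 = v ∧ rowPart v p i = true) (hq : colPart v q i = true) :
    Function.Injective fun j => interRect v i j (colPart (!v) q j) := by
  intro j j' h
  by_contra hne
  -- Flipping the irrelevant column string at `j'` leads out of only one of the two rectangles.
  obtain ⟨r, hr1, hr2⟩ : ∃ r : Str n × Str n, colPart v r = colPart v q ∧
      colPart (!v) r = Function.update (colPart (!v) q) j' (!colPart (!v) q j') := by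
    cases v
    · exact ⟨(Function.update q.1 j' (!q.1 j'), q.2), by simp [colPart], by simp [colPart]⟩
    · exact ⟨(q.1, Function.update q.2 j' (!q.2 j')), by simp [colPart], by simp [colPart]⟩
  have h1 : (p, r) ∈ interRect v i j (colPart (!v) q j) :=
    mem_interRect.2 ⟨hp, by rw [hr1, hq], by rw [hr2, Function.update_of_ne hne]⟩
  have h2 : (p, r) ∈ interRect v i j' (colPart (!v) q j') := by
    have h' : interRect v i j (colPart (!v) q j) = interRect v i j' (colPart (!v) q j') := h
    rwa [← h']
  have h3 := (mem_interRect.1 h2).2.2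
  rw [hr2, Function.update_self] at h3
  cases h4 : colPart (!v) q j' <;> simp [h4] at h3

open Classical in
/-- The cover: given `a`, the relevant strings are disjoint by default, and the answer is then `a`;
this is overruled by the rectangles that witness an intersection. -/
noncomputable def bothCover (n : ℕ) :
    Finset (Finset ((Str n × Str n × Bool) × (Str n × Str n)) × Bool) :=
  (univ.image fun v : Bool => (defaultRect n v, v)) ∪
    univ.image fun t : Bool × Fin n × Fin n × Bool =>
      (interRect t.1 t.2.1 t.2.2.1 t.2.2.2, !t.1)

theorem card_bothCover_le (n : ℕ) : (bothCover n).card ≤ 4 * n ^ 2 + 2 := by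
  classical
  refine (card_union_le _ _).trans ?_
  refine (add_le_add card_image_le card_image_le).trans (le_of_eq ?_)
  simp only [card_univ, Fintype.card_bool, Fintype.card_prod, Fintype.card_fin]
  ring

theorem labelCount_eq_card {X Y : Type} (C : Finset (Finset (X × Y) × Bool)) (x : X) (y : Y)
    (v : Bool) [DecidablePred fun R : Finset (X × Y) × Bool => (x, y) ∈ R.1 ∧ R.2 = v] :
    labelCount C x y v = (C.filter fun R => (x, y) ∈ R.1 ∧ R.2 = v).card := by
  unfold labelCount
  congr!

theorem labelCount_self_le (p : Str n × Str n × Bool) (q : Str n × Str n) :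
    labelCount (bothCover n) p q p.2.2 ≤ 1 := by
  classical
  rw [labelCount_eq_card]
  refine card_le_one_iff_subset_singleton.2 ⟨(defaultRect n p.2.2, p.2.2), fun R hR => ?_⟩
  rw [mem_filter, bothCover, mem_union, mem_image, mem_image] at hR
  obtain ⟨⟨v, -, rfl⟩ | ⟨⟨v, i, j, b⟩, -, rfl⟩, h1, h2⟩ := hR
  · simp only at h2
    rw [h2, mem_singleton]
  · have h3 := (mem_interRect.1 h1).1.1
    simp only at h2 h3
    rw [h3] at h2
    cases v <;> simp at h2

theorem one_le_labelCount_self (p : Str n × Str n × Bool) (q : Str n × Str n) :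
    1 ≤ labelCount (bothCover n) p q p.2.2 := by
  classical
  rw [labelCount_eq_card]
  refine Nat.succ_le_of_lt <| card_pos.2 ⟨(defaultRect n p.2.2, p.2.2), ?_⟩
  rw [mem_filter, bothCover, mem_union, mem_image]
  exact ⟨Or.inl ⟨_, mem_univ _, rfl⟩, mem_defaultRect.2 rfl, rfl⟩

theorem labelCount_not_of_disj {p : Str n × Str n × Bool} {q : Str n × Str n}
    (h : DISJ n (rowPart p.2.2 p) (colPart p.2.2 q) = true) :
    labelCount (bothCover n) p q (!p.2.2) = 0 := by
  classical
  rw [labelCount_eq_card]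
  refine card_eq_zero.2 (filter_eq_empty_iff.2 fun R hR => ?_)
  rw [bothCover, mem_union, mem_image, mem_image] at hR
  rintro ⟨h1, h2⟩
  obtain ⟨v, -, rfl⟩ | ⟨⟨v, i, j, b⟩, -, rfl⟩ := hR
  · have h3 := mem_defaultRect.1 h1
    simp only at h2
    rw [h3] at h2
    cases v <;> simp at h2
  · obtain ⟨⟨h3, h4⟩, h5, -⟩ := mem_interRect.1 h1
    simp only at h3 h4 h5
    subst h3
    exact DISJ_eq_true.1 h i ⟨h4, h5⟩

theorem le_labelCount_not_of_inter {p : Str n × Str n × Bool} {q : Str n × Str n}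
    (h : DISJ n (rowPart p.2.2 p) (colPart p.2.2 q) = false) :
    n ≤ labelCount (bothCover n) p q (!p.2.2) := by
  classical
  rw [← Bool.not_eq_true, DISJ_eq_true] at h
  push Not at h
  obtain ⟨i, h1, h2⟩ := h
  set v := p.2.2 with hv
  have hsub : univ.image (fun j => (interRect v i j (colPart (!v) q j), !v)) ⊆
      (bothCover n).filter fun R => (p, q) ∈ R.1 ∧ R.2 = !v := by
    intro R hR
    obtain ⟨j, -, rfl⟩ := mem_image.1 hR
    rw [mem_filter, bothCover, mem_union, mem_image, mem_image]
    exact ⟨Or.inr ⟨(v, i, j, colPart (!v) q j), mem_univ _, rfl⟩,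
      mem_interRect.2 ⟨⟨rfl, h1⟩, h2, rfl⟩, rfl⟩
  have hinj : Function.Injective fun j => (interRect v i j (colPart (!v) q j), !v) :=
    fun j j' hj => interRect_injective ⟨hv.symm, h1⟩ h2 (Prod.ext_iff.1 hj).1
  have := card_le_card hsub
  rw [card_image_of_injective _ hinj, card_univ, Fintype.card_fin] at this
  rwa [labelCount_eq_card]

theorem isApproxMajorityCover_bothCover (hn : 3 ≤ n) :
    IsApproxMajorityCover (BOTH n) (bothCover n) := by
  classical
  have hrect : ∀ R ∈ bothCover n, IsRectangle R.1 := by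
    intro R hR
    rw [bothCover, mem_union, mem_image, mem_image] at hR
    obtain ⟨v, -, rfl⟩ | ⟨t, -, rfl⟩ := hR
    · exact ⟨_, _, rfl⟩
    · exact ⟨_, _, rfl⟩
  have key : ∀ p q, 1 ≤ labelCount (bothCover n) p q (BOTH n p q) ∧
      3 * labelCount (bothCover n) p q (!BOTH n p q) ≤
        labelCount (bothCover n) p q (BOTH n p q) := by
    intro p q
    have h1 := labelCount_self_le p q
    have h2 := one_le_labelCount_self p q
    rw [BOTH_eq]
    cases h : DISJ n (rowPart p.2.2 p) (colPart p.2.2 q)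
    · have h3 := le_labelCount_not_of_inter h
      have e : (false == p.2.2) = !p.2.2 := by cases p.2.2 <;> rfl
      rw [e, Bool.not_not]
      omega
    · have h3 := labelCount_not_of_disj h
      have e : (true == p.2.2) = p.2.2 := by cases p.2.2 <;> rfl
      rw [e, h3]
      omega
  refine ⟨⟨hrect, fun p q => ?_⟩, fun p q => ?_⟩
  · obtain ⟨h1, h2⟩ := key p q
    constructor <;> intro h <;> rw [h] at h1 h2 <;> simp at h1 h2 <;> omega
  · obtain ⟨h1, h2⟩ := key p q
    have h2' : (3 : ℝ) * labelCount (bothCover n) p q (!BOTH n p q) ≤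
        labelCount (bothCover n) p q (BOTH n p q) := by exact_mod_cast h2
    cases h : BOTH n p q <;> rw [h] at h2' <;> simp at h2' <;> linarith

theorem APP_BOTH_le (hn : 5 ≤ n) : APP (BOTH n) ≤ 3 * Real.logb 2 n := by
  have h1 : sInf {P : ℕ | ∃ C, IsApproxMajorityCover (BOTH n) C ∧ C.card = P} ≤
      4 * n ^ 2 + 2 :=
    le_trans (Nat.sInf_le ⟨bothCover n, isApproxMajorityCover_bothCover (by omega), rfl⟩)
      (card_bothCover_le n)
  have h2 : 4 * n ^ 2 + 2 ≤ n ^ 3 := by nlinarith [sq_nonneg n]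
  have h3 : 3 * Real.logb 2 n = Real.logb 2 ((n : ℝ) ^ 3) := by
    rw [Real.logb_pow]
    norm_num
  rw [h3, APP]
  -- In the degenerate case of size `0` the convention `logb 2 0 = 0` suffices.
  rcases Nat.eq_zero_or_pos
    (sInf {P : ℕ | ∃ C, IsApproxMajorityCover (BOTH n) C ∧ C.card = P}) with h0 | h0
  · rw [h0, Nat.cast_zero, Real.logb_zero]
    exact Real.logb_nonneg one_lt_two (one_le_pow₀ (by exact_mod_cast (by omega : 1 ≤ n)))
  · refine Real.logb_le_logb_of_le one_lt_two (Nat.cast_pos.2 h0) ?_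
    exact_mod_cast h1.trans h2

end ApproxMajority

end CommCx

theorem mainTheorem5 :
    (∃ C : ℝ, 0 < C ∧ ∃ n₀ : ℕ, ∀ n : ℕ, n₀ ≤ n →
      CommCx.APP (CommCx.BOTH n) ≤ C * Real.logb 2 n) ∧
    (∃ c : ℝ, 0 < c ∧ ∃ n₀ : ℕ, ∀ n : ℕ, n₀ ≤ n →
      c * n ≤ CommCx.bound1 (CommCx.BOTH n) ∧
      c * n ≤ CommCx.bound1 (CommCx.neg (CommCx.BOTH n))) ∧
    (∃ c : ℝ, 0 < c ∧ ∃ n₀ : ℕ, ∀ n : ℕ, n₀ ≤ n → ∀ s : ℕ, 1 ≤ s →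
      c * n ≤ (CommCx.UT1 s (2 * s) (CommCx.BOTH n) : ℝ) ∧
      c * n ≤ (CommCx.UT1 s (2 * s) (CommCx.neg (CommCx.BOTH n)) : ℝ)) ∧
    (∃ c : ℝ, 0 < c ∧ ∃ n₀ : ℕ, ∀ n : ℕ, n₀ ≤ n →
      c * Real.sqrt n ≤ (CommCx.MA (CommCx.BOTH n) : ℝ) ∧
      c * Real.sqrt n ≤ (CommCx.MA (CommCx.neg (CommCx.BOTH n)) : ℝ)) := by
  have hη : ∀ n : ℕ, 0 ≤ 10 * Real.exp (-(n / 3200 : ℝ)) := fun n => by positivity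
  refine ⟨⟨3, by norm_num, 5, fun n hn => CommCx.APP_BOTH_le hn⟩,
    ⟨1 / 6400, by norm_num, 25600, fun n hn => ?_⟩,
    ⟨1 / 6400, by norm_num, 25600, fun n hn s hs => ?_⟩,
    ⟨1 / 160, by norm_num, 102400, fun n hn => ?_⟩⟩
  · have key : ∀ f : CommCx.Str n × CommCx.Str n × Bool → CommCx.Str n × CommCx.Str n → Bool,
        CommCx.HasCorruption f (10 * Real.exp (-(n / 3200 : ℝ))) →
          1 / 6400 * (n : ℝ) ≤ CommCx.bound1 f := fun f hf => by
      obtain ⟨P, hP, hb⟩ := hf.le_bound1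
      exact (CommCx.le_logb_of_one_le hn hP).trans hb
    exact ⟨key _ (CommCx.hasCorruption_BOTH (by omega)),
      key _ (CommCx.hasCorruption_neg_BOTH (by omega))⟩
  · have key : ∀ f : CommCx.Str n × CommCx.Str n × Bool → CommCx.Str n × CommCx.Str n → Bool,
        CommCx.HasCorruption f (10 * Real.exp (-(n / 3200 : ℝ))) →
          1 / 6400 * (n : ℝ) ≤ (CommCx.UT1 s (2 * s) f : ℝ) := fun f hf => by
      obtain ⟨P, hP, hb⟩ := hf.le_UT1 (hη n) hs
      exact (CommCx.le_logb_of_one_le hn hP).trans hb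
    exact ⟨key _ (CommCx.hasCorruption_BOTH (by omega)),
      key _ (CommCx.hasCorruption_neg_BOTH (by omega))⟩
  · exact ⟨CommCx.le_sqrt_of_one_le hn ((CommCx.hasCorruption_BOTH (by omega)).le_MA (hη n)),
      CommCx.le_sqrt_of_one_le hn ((CommCx.hasCorruption_neg_BOTH (by omega)).le_MA (hη n))⟩
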